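/- Equations with "maxima". Define $K_n$ for $n\ge 1$ (the Favard constants) by $$K_n=\frac{(2^{n+1}-1)\,|B_{n+1}|}{2^{n-1}(n+1)!}\ \text{ if } n \text{ is odd},\qquad K_n=\frac{|E_n|}{4^n\,n!}\ \text{ if } n \text{ is even},$$ where $B_k$ are the Bernoulli numbers and $E_k$ the Euler numbers ($1/\cosh t=\sum_k E_k t^k/k!$); thus $K_1=\frac14$, $K_2=\frac1{32}$, $K_3=\frac1{192}$. Let $n\ge1$ be an integer and $T>0$. A solution of an equation $x^{(n)}(t)=q(t)\max_{s\in[\tau(t),\theta(t)]}x(s)$ is a function $x:\mathbb R\to\mathbb R$ whose derivatives up to order $n-1$ exist and are locally absolutely continuous and which satisfies the equation for almost every $t\in\mathbb R$. (a) Let $L\in\mathbb R$ and let $\tau,\theta:\mathbb R\to\mathbb R$ be measurable with $\tau(t)\le\theta(t)$ for all $t$. If the equation $$x^{(n)}(t)=L\max_{s\in[\tau(t),\theta(t)]}x(s),\qquad t\in\mathbb R,$$ has a non-constant $T$-periodic solution, then $|L|\,T^n\ge \dfrac1{K_n}$. (b) Inequality (a) is sharp: for all $n\ge1$, $T>0$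 and $L\in\mathbb R$ with $|L|\,T^n=1/K_n$ there exist measurable $\tau\le\theta$ for which the equation in (a) has a non-constant $T$-periodic solution. (c) Let $p:\mathbb R\to\mathbb R$ be locally integrable and $T$-periodic with $p(t)>0$ for all $t$, and let $\tau\le\theta$ be measurable functions $\mathbb R\to\mathbb R$. If the equation $$x^{(n)}(t)=p(t)\max_{s\in[\tau(t),\theta(t)]}x(s),\qquad t\in\mathbb R,$$ has a non-constant $T$-periodic solution, then $$\int_0^T p(t)\,dt\ge 4\ \text{ if } n=1,\qquad T^{n-1}\int_0^T p(t)\,dt>\frac4{K_{n-1}}\ \text{ if } n\ge2.$$ (d) The inequalities in (c) are sharp. If $n=1$, then for every $T>0$ there exist $p,\tau,\theta$ as in (c) with $\int_0^T p(t)\,dt=4$ for which the equation in (c) has a non-constant $T$-periodic solution. If $n\ge2$, then for all $T>0$ and all $P$ with $P\,T^{n-1}>4/K_{n-1}$ there exist $p,\tau,\theta$ as in (c) with $\int_0^T p(t)\,dt=P$ for which the equation in (c) has a non-constant $T$-periodic solution. -/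

import Mathlib

open MeasureTheory

/-- The Euler numbers `E₀ = 1, E₁ = 0, E₂ = -1, E₃ = 0, E₄ = 5, E₅ = 0, E₆ = -61, …`, that is
`1 / cosh t = ∑ Eₙ tⁿ / n!`.  The recursion compares coefficients in `cosh t * (1 / cosh t) = 1`:
for `n ≥ 1` the sum of `(n choose k) E_k` over all `k ≤ n` with `n - k` even is zero. -/
def eulerNumber : ℕ → ℤ
  | 0 => 1
  | n + 1 => -∑ k : Fin (n + 1),
      if Even (n + 1 - (k : ℕ)) then ((n + 1).choose (k : ℕ) : ℤ) * eulerNumber (k : ℕ) else 0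

/-- The Favard constants: `K₁ = 1/4, K₂ = 1/32, K₃ = 1/192, K₄ = 5/6144, …`. -/
def favardConst (n : ℕ) : ℚ :=
  if Odd n then
    (2 ^ (n + 1) - 1) * |bernoulli (n + 1)| / (2 ^ (n - 1) * (Nat.factorial (n + 1) : ℚ))
  else
    |(eulerNumber n : ℚ)| / (4 ^ n * (Nat.factorial n : ℚ))

/-- `x` is a (Carathéodory) solution on the whole line of the `n`-th order equation
`x⁽ⁿ⁾(t) = q(t) * max_{s ∈ [τ(t), θ(t)]} x(s)`, for `n ≥ 1`: the derivatives of `x` up to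
order `n - 1` exist and are locally absolutely continuous, and the equation holds for almost
every `t`.  As `x` is continuous and (where this is used) `τ t ≤ θ t`, the supremum is the maximum
of `x` on a non-empty compact interval. -/
structure IsMaximaSolution (n : ℕ) (q τ θ x : ℝ → ℝ) : Prop where
  contDiff : ContDiff ℝ ((n - 1 : ℕ) : ℕ∞) x
  absolutelyContinuous : ∀ a b : ℝ, AbsolutelyContinuousOnInterval (iteratedDeriv (n - 1) x) a b
  equation : ∀ᵐ t : ℝ, iteratedDeriv n x t = q t * sSup (x '' Set.Icc (τ t) (θ t))

/-- `x` is a non-constant `T`-periodic solution of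
`x⁽ⁿ⁾(t) = q(t) * max_{s ∈ [τ(t), θ(t)]} x(s)`. -/
structure IsNonconstantPeriodicMaximaSolution (n : ℕ) (T : ℝ) (q τ θ x : ℝ → ℝ) : Prop where
  solution : IsMaximaSolution n q τ θ x
  periodic : Function.Periodic x T
  nonconstant : ¬ ∃ c : ℝ, ∀ t : ℝ, x t = c

/-- The admissible coefficients `p`: positive, locally integrable, `T`-periodic. -/
structure IsPositivePeriodicCoeff (T : ℝ) (p : ℝ → ℝ) : Prop where
  pos : ∀ t : ℝ, 0 < p t
  locallyIntegrable : LocallyIntegrable p volume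
  periodic : Function.Periodic p T

/-!
For a nonconstant periodic solution put `m = min x` and `M = max x`. The maxima on the right-hand
side of the equation lie in `[m, M]`, so everything rests on comparing the oscillation `M - m` of a
periodic function with the range of its highest derivative.

*Constant coefficient.* Integration by parts recovers `x` from `x⁽ⁿ⁾`, up to the mean and a sign, by
means of the kernel `Bₙ((v - t) / T) / n!` on `[t, t + T]`
(`integral_periodKernel_mul_iteratedDeriv`). As `x⁽ⁿ⁾` has mean zero, the kernel may be replaced by
`Bₙ / n! - c`, and then `x⁽ⁿ⁾` by `x⁽ⁿ⁾ - d`, at the price of a term which does not depend on `t`.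
Hence `M - m ≤ 2 r Tⁿ ∫₀¹ |Bₙ / n! - c|` if `|x⁽ⁿ⁾ - d| ≤ r` (`sub_le_of_ae_iteratedDeriv_mem`). For
the best `c` the integral is the Favard constant `Kₙ` (`integral_abs_normBernoulli_sub_bestConst`):
the odd Bernoulli polynomials do not vanish on `(0, 1/2)` (`normBernoulli_odd_sign`), so the even
ones are monotone there. This determines the sign of `Bₙ / n! - c`, and the integral becomes the
absolute value of an Euler polynomial at `0` or at `1/2`; these values are given by the Bernoulli
and the Euler numbers (`favardConst_eq_abs_halfEuler`).

*Positive periodic coefficient.* For `z = x⁽ⁿ⁻¹⁾` one has `z' = p y` with `m ≤ y ≤ M`, and comparing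
the rise and the fall of `z` over a period gives `max z - min z ≤ (M - m) / 4 * ∫ p`
(`sub_le_quarter_mul_integral`). For `n = 1` this is the claim; for `n ≥ 2` the estimate above for
the order `n - 1` completes the proof. It is strict because `z` is continuous and not constant
(`sub_lt_of_iteratedDeriv_mem`).

*Sharpness.* The perfect spline, the `n`-fold antiperiodic primitive of a square wave, takes the
values `± Kₙ Tⁿ` at two points half a period apart, so for constant coefficients with equality the
intervals `[τ t, θ t]` can be taken to be one of these two points. For `n ≥ 2` and
`P Tⁿ⁻¹ > 4 / Kₙ₋₁` the difference quotient over a short step `ε` of this spline is used. Its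
value at the extremal point of the spline of degree `n - 1` is close to `± Kₙ₋₁ Tⁿ⁻¹`, and its
`n`-th derivative is `± 2 / ε` on two intervals of length `ε` and zero elsewhere. Where it is zero
the interval `[τ t, θ t]` is taken to be a zero of `x`, so that `p` is free there and can be used
to adjust its integral (`exists_solution_of_lt`).
-/

/-! ### Normalised Bernoulli polynomials -/

/-- The Bernoulli polynomial divided by `n!`, so that each member of the sequence is the derivative
of the next one. -/
noncomputable def normBernoulli (n : ℕ) (x : ℝ) : ℝ := bernoulliFun n x / (n.factorial : ℝ)

lemma continuous_normBernoulli (n : ℕ) : Continuous (normBernoulli n) :=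
  (continuous_bernoulliFun n).div_const _

lemma normBernoulli_zero (x : ℝ) : normBernoulli 0 x = 1 := by simp [normBernoulli]

lemma normBernoulli_one (x : ℝ) : normBernoulli 1 x = x - 1 / 2 := by simp [normBernoulli]

lemma hasDerivAt_normBernoulli (n : ℕ) (x : ℝ) :
    HasDerivAt (normBernoulli (n + 1)) (normBernoulli n x) x := by
  have h := (hasDerivAt_bernoulliFun (n + 1) x).div_const ((n + 1).factorial : ℝ)
  convert! h using 1
  simp only [normBernoulli, Nat.factorial_succ, Nat.add_sub_cancel]
  push_cast
  field_simp

lemma normBernoulli_one_sub (n : ℕ) (x : ℝ) :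
    normBernoulli n (1 - x) = (-1) ^ n * normBernoulli n x := by
  simp only [normBernoulli, bernoulliFun_eval_one_sub]
  ring

lemma normBernoulli_eval_one {n : ℕ} (hn : n ≠ 1) : normBernoulli n 1 = normBernoulli n 0 := by
  simp [normBernoulli, bernoulliFun_endpoints_eq_of_ne_one hn]

lemma normBernoulli_odd_zero {n : ℕ} (hn : Odd n) (h1 : n ≠ 1) : normBernoulli n 0 = 0 := by
  have h := normBernoulli_one_sub n 0
  rw [sub_zero, normBernoulli_eval_one h1, hn.neg_one_pow] at h
  linarith

lemma normBernoulli_odd_half {n : ℕ} (hn : Odd n) : normBernoulli n (1 / 2) = 0 := by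
  have h := normBernoulli_one_sub n (1 / 2)
  rw [hn.neg_one_pow, show (1 : ℝ) - 1 / 2 = 1 / 2 by norm_num] at h
  linarith

lemma integral_normBernoulli (n : ℕ) (a b : ℝ) :
    ∫ v in a..b, normBernoulli n v = normBernoulli (n + 1) b - normBernoulli (n + 1) a :=
  intervalIntegral.integral_eq_sub_of_hasDerivAt (fun v _ => hasDerivAt_normBernoulli n v)
    ((continuous_normBernoulli n).intervalIntegrable _ _)

lemma exists_normBernoulli_ne (n : ℕ) (c : ℝ) {U : Set ℝ} (hU : IsOpen U) (hne : U.Nonempty) :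
    ∃ v ∈ U, normBernoulli (n + 1) v ≠ c := by
  induction n generalizing c with
  | zero =>
    by_contra! h
    obtain ⟨u, hu⟩ := hne
    have h1 : HasDerivAt (normBernoulli (0 + 1)) 0 u :=
      (hasDerivAt_const u c).congr_of_eventuallyEq (Filter.eventuallyEq_of_mem (hU.mem_nhds hu) h)
    have h2 := h1.unique (hasDerivAt_normBernoulli 0 u)
    rw [normBernoulli_zero] at h2
    norm_num at h2
  | succ n ih =>
    by_contra! h
    obtain ⟨u, hu, hne⟩ := ih 0
    have h1 : HasDerivAt (normBernoulli (n + 1 + 1)) 0 u :=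
      (hasDerivAt_const u c).congr_of_eventuallyEq (Filter.eventuallyEq_of_mem (hU.mem_nhds hu) h)
    exact hne (h1.unique (hasDerivAt_normBernoulli (n + 1) u)).symm

lemma strictMonoOn_normBernoulli_of_pos {n : ℕ} {σ : ℝ}
    (h : ∀ x ∈ Set.Ioo (0 : ℝ) (1 / 2), 0 < σ * normBernoulli n x) :
    StrictMonoOn (fun x => σ * normBernoulli (n + 1) x) (Set.Icc 0 (1 / 2)) := by
  refine strictMonoOn_of_deriv_pos (convex_Icc _ _)
    (continuous_const.mul (continuous_normBernoulli _)).continuousOn fun x hx => ?_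
  rw [interior_Icc] at hx
  rw [((hasDerivAt_normBernoulli n x).const_mul σ).deriv]
  exact h x hx

/-- On `(0, 1/2)` the odd Bernoulli polynomials have no zero: each of them vanishes at the ends of
the interval and is strictly convex or strictly concave there, as its derivative is monotone by the
sign of the previous one. -/
lemma normBernoulli_odd_sign (k : ℕ) :
    ∀ x ∈ Set.Ioo (0 : ℝ) (1 / 2), 0 < (-1) ^ (k + 1) * normBernoulli (2 * k + 1) x := by
  induction k with
  | zero =>
    intro x hx
    rw [Nat.mul_zero, Nat.zero_add, normBernoulli_one]
    linarith [hx.2]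
  | succ k ih =>
    intro x hx
    have hmono := strictMonoOn_normBernoulli_of_pos ih
    have hconv : StrictConvexOn ℝ (Set.Icc (0 : ℝ) (1 / 2))
        (fun x => (-1) ^ (k + 1) * normBernoulli (2 * k + 3) x) := by
      refine StrictMonoOn.strictConvexOn_of_deriv (convex_Icc _ _)
        (continuous_const.mul (continuous_normBernoulli _)).continuousOn ?_
      have hd : deriv (fun x => (-1 : ℝ) ^ (k + 1) * normBernoulli (2 * k + 3) x) =
          fun x => (-1) ^ (k + 1) * normBernoulli (2 * k + 2) x :=
        funext fun x => ((hasDerivAt_normBernoulli (2 * k + 2) x).const_mul _).deriv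
      rw [hd]
      exact hmono.mono interior_subset
    have hodd : Odd (2 * k + 3) := ⟨k + 1, by ring⟩
    have h := hconv.2 (show (0 : ℝ) ∈ Set.Icc (0 : ℝ) (1 / 2) by norm_num)
      (show (1 / 2 : ℝ) ∈ Set.Icc (0 : ℝ) (1 / 2) by norm_num) (by norm_num)
      (show 0 < 1 - 2 * x by linarith [hx.2]) (show 0 < 2 * x by linarith [hx.1]) (by ring)
    simp only [smul_eq_mul, normBernoulli_odd_zero hodd (by omega), normBernoulli_odd_half hodd]
      at h
    rw [show (1 - 2 * x) * 0 + 2 * x * (1 / 2) = x by ring] at h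
    rw [show 2 * (k + 1) + 1 = 2 * k + 3 by ring, pow_succ]
    linarith

/-! ### The Favard constants as values of Euler polynomials -/

/-- The Euler polynomial `Eₙ(2t) / (2ⁿ n!)`, written as a difference of Bernoulli polynomials. -/
noncomputable def halfEuler (n : ℕ) (t : ℝ) : ℝ :=
  2 * (normBernoulli (n + 1) (t + 1 / 2) - normBernoulli (n + 1) t)

lemma halfEuler_zero (t : ℝ) : halfEuler 0 t = 1 := by
  simp only [halfEuler, Nat.zero_add, normBernoulli_one]
  ring

lemma hasDerivAt_halfEuler (n : ℕ) (t : ℝ) :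
    HasDerivAt (halfEuler (n + 1)) (halfEuler n t) t :=
  (((hasDerivAt_normBernoulli (n + 1) (t + 1 / 2)).comp_add_const t (1 / 2)).sub
    (hasDerivAt_normBernoulli (n + 1) t)).const_mul 2

lemma halfEuler_half (n : ℕ) : halfEuler (n + 1) (1 / 2) = -halfEuler (n + 1) 0 := by
  simp only [halfEuler]
  rw [zero_add, show (1 / 2 : ℝ) + 1 / 2 = 1 by norm_num, normBernoulli_eval_one (by omega)]
  ring

/-- Taylor's formula for an Appell sequence. -/
lemma appell_eval_add {f : ℕ → ℝ → ℝ} (h0 : ∀ x y, f 0 x = f 0 y)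
    (hf : ∀ n x, HasDerivAt (f (n + 1)) (f n x) x) (n : ℕ) (x y : ℝ) :
    f n (x + y) = ∑ k ∈ Finset.range (n + 1), f (n - k) x * (y ^ k / (k.factorial : ℝ)) := by
  induction n generalizing y with
  | zero => simp [h0 (x + y) x]
  | succ n ih =>
    have hd : ∀ y, HasDerivAt (fun y => f (n + 1) (x + y) -
        ∑ k ∈ Finset.range (n + 1 + 1), f (n + 1 - k) x * (y ^ k / (k.factorial : ℝ))) 0 y := by
      intro y
      have h1 : HasDerivAt (fun y => f (n + 1) (x + y)) (f n (x + y)) y :=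
        (hf n (x + y)).comp_const_add x y
      have h2 : HasDerivAt (fun y : ℝ => ∑ k ∈ Finset.range (n + 1),
          f (n - k) x * (y ^ (k + 1) / ((k + 1).factorial : ℝ)))
          (∑ k ∈ Finset.range (n + 1), f (n - k) x * (y ^ k / (k.factorial : ℝ))) y := by
        refine HasDerivAt.fun_sum fun k _ => ?_
        convert! ((hasDerivAt_pow (k + 1) y).div_const ((k + 1).factorial : ℝ)).const_mul
          (f (n - k) x) using 1
        rw [Nat.factorial_succ]
        push_cast
        field_simp
      have h3 := h1.sub (h2.add_const (f (n + 1) x))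
      rw [← ih, sub_self] at h3
      refine h3.congr_of_eventuallyEq (Filter.Eventually.of_forall fun z => ?_)
      simp only [Pi.sub_apply]
      rw [Finset.sum_range_succ']
      simp
    have hc := is_const_of_deriv_eq_zero (fun z => (hd z).differentiableAt)
      (fun z => (hd z).deriv) y 0
    have hz : ∑ k ∈ Finset.range (n + 1 + 1),
        f (n + 1 - k) x * ((0 : ℝ) ^ k / (k.factorial : ℝ)) = f (n + 1) x := by
      rw [Finset.sum_range_succ']
      simp
    simp only [hz, add_zero, sub_self] at hc
    linarith

lemma eulerNumber_succ (n : ℕ) : (eulerNumber (n + 1) : ℝ) =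
    -∑ k ∈ Finset.range (n + 1),
      if Even (k + 1) then ((n + 1).choose (k + 1) : ℝ) * eulerNumber (n - k) else 0 := by
  have h : eulerNumber (n + 1) = -∑ k ∈ Finset.range (n + 1),
      if Even (n + 1 - k) then ((n + 1).choose k : ℤ) * eulerNumber k else 0 := by
    rw [eulerNumber, Fin.sum_univ_eq_sum_range
      (fun k => if Even (n + 1 - k) then ((n + 1).choose k : ℤ) * eulerNumber k else 0)]
  rw [h, ← Finset.sum_range_reflect]
  push_cast
  congr 1
  refine Finset.sum_congr rfl fun k hk => ?_
  have hk' : k ≤ n := by simpa [Nat.lt_succ_iff] using hk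
  rw [show n + 1 - (n - k) = k + 1 by omega,
    ← Nat.choose_symm (show k + 1 ≤ n + 1 by omega), show n + 1 - (k + 1) = n - k by omega]

/-- The value at the midpoint `1/4` gives the Euler number: the recursion defining `eulerNumber` is
the Taylor expansion at `1/4` of `halfEuler n 0 + halfEuler n (1/2) = 0`. -/
lemma halfEuler_quarter (n : ℕ) :
    halfEuler n (1 / 4) = (eulerNumber n : ℝ) / (4 ^ n * (n.factorial : ℝ)) := by
  induction n using Nat.strong_induction_on with
  | _ n ih =>
    cases n with
    | zero => simp [halfEuler_zero, eulerNumber]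
    | succ n =>
      have ht := appell_eval_add (f := halfEuler) (fun x y => by simp only [halfEuler_zero])
        hasDerivAt_halfEuler (n + 1) (1 / 4)
      have h1 := ht (1 / 4)
      have h2 := ht (-(1 / 4))
      rw [show (1 / 4 : ℝ) + 1 / 4 = 1 / 2 by norm_num, halfEuler_half] at h1
      rw [show (1 / 4 : ℝ) + -(1 / 4) = 0 by norm_num] at h2
      have h3 : ∑ k ∈ Finset.range (n + 1 + 1), halfEuler (n + 1 - k) (1 / 4) *
          ((1 / 4) ^ k / (k.factorial : ℝ)) + ∑ k ∈ Finset.range (n + 1 + 1),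
          halfEuler (n + 1 - k) (1 / 4) * ((-(1 / 4)) ^ k / (k.factorial : ℝ)) = 0 := by
        linarith
      rw [← Finset.sum_add_distrib, Finset.sum_range_succ'] at h3
      have h4 : ∀ k ∈ Finset.range (n + 1),
          halfEuler (n + 1 - (k + 1)) (1 / 4) * ((1 / 4) ^ (k + 1) / ((k + 1).factorial : ℝ)) +
          halfEuler (n + 1 - (k + 1)) (1 / 4) * ((-(1 / 4)) ^ (k + 1) / ((k + 1).factorial : ℝ)) =
          2 / (4 ^ (n + 1) * ((n + 1).factorial : ℝ)) *
          (if Even (k + 1) then ((n + 1).choose (k + 1) : ℝ) * eulerNumber (n - k) else 0) := by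
        intro k hk
        have hk' : k ≤ n := by simpa [Nat.lt_succ_iff] using hk
        rw [show n + 1 - (k + 1) = n - k by omega, ih (n - k) (by omega)]
        split_ifs with he
        · rw [he.neg_pow, Nat.cast_choose ℝ (show k + 1 ≤ n + 1 by omega),
            show n + 1 - (k + 1) = n - k by omega,
            show (4 : ℝ) ^ (n + 1) = 4 ^ (n - k) * 4 ^ (k + 1) by
              rw [← pow_add]; congr 1; omega]
          field_simp
          rw [one_div, inv_pow]
          field_simp
          norm_num
        · rw [(Nat.not_even_iff_odd.1 he).neg_pow]
          ring
      rw [Finset.sum_congr rfl h4, ← Finset.mul_sum] at h3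
      simp only [Nat.sub_zero, pow_zero, Nat.factorial_zero, Nat.cast_one, div_one, mul_one] at h3
      rw [eulerNumber_succ]
      have h5 : halfEuler (n + 1) (1 / 4) = -(1 / (4 ^ (n + 1) * ((n + 1).factorial : ℝ)) *
          ∑ k ∈ Finset.range (n + 1),
            if Even (k + 1) then ((n + 1).choose (k + 1) : ℝ) * eulerNumber (n - k) else 0) := by
        linear_combination h3 / 2
      rw [h5]
      ring

/-- The point of `[0, 1/2)` at which the Euler polynomial `halfEuler n` is extremal. -/
noncomputable def extremalPoint (n : ℕ) : ℝ := if Odd n then 0 else 1 / 4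

lemma favardConst_eq_abs_halfEuler (n : ℕ) :
    (favardConst n : ℝ) = |halfEuler n (extremalPoint n)| := by
  unfold favardConst extremalPoint
  split_ifs with hn
  · rw [halfEuler, zero_add, normBernoulli, normBernoulli, ← inv_eq_one_div,
      bernoulliFun_eval_half, bernoulliFun_eval_zero]
    have h2 : (2 : ℝ) * ((2 / 2 ^ (n + 1) - 1) * (bernoulli (n + 1) : ℝ) / ((n + 1).factorial : ℝ) -
        (bernoulli (n + 1) : ℝ) / ((n + 1).factorial : ℝ)) =
        -((2 ^ (n + 1) - 1) / (2 ^ (n - 1) * ((n + 1).factorial : ℝ)) *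
          (bernoulli (n + 1) : ℝ)) := by
      obtain ⟨m, rfl⟩ : ∃ m, n = m + 1 := ⟨n - 1, by have := hn.pos; omega⟩
      rw [Nat.add_sub_cancel, pow_succ, pow_succ]
      field_simp
      ring
    have h3 : (0 : ℝ) ≤ (2 ^ (n + 1) - 1) / (2 ^ (n - 1) * ((n + 1).factorial : ℝ)) :=
      div_nonneg (sub_nonneg.2 (one_le_pow₀ (by norm_num))) (by positivity)
    rw [h2, abs_neg, abs_mul, abs_of_nonneg h3]
    push_cast
    ring
  · rw [halfEuler_quarter, abs_div, abs_of_nonneg (show (0 : ℝ) ≤ 4 ^ n * (n.factorial : ℝ) by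
      positivity)]
    push_cast
    rfl

/-- The constant of best `L¹` approximation to the Bernoulli polynomial on `[0, 1]`. -/
noncomputable def bestConst (n : ℕ) : ℝ := if Odd n then 0 else normBernoulli n (1 / 4)

lemma integral_eq_two_mul_of_symm {f : ℝ → ℝ} (hf : Continuous f) (hs : ∀ v, f (1 - v) = f v) :
    ∫ v in (0 : ℝ)..1, f v = 2 * ∫ v in (0 : ℝ)..(1 / 2), f v := by
  rw [← intervalIntegral.integral_add_adjacent_intervals (hf.intervalIntegrable 0 (1 / 2))
    (hf.intervalIntegrable (1 / 2) 1)]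
  have h : ∫ v in (1 / 2 : ℝ)..1, f v = ∫ v in (0 : ℝ)..(1 / 2), f v := by
    have h1 := intervalIntegral.integral_comp_sub_left (a := 0) (b := 1 / 2) f 1
    simp only [hs] at h1
    rw [h1]
    norm_num
  rw [h]
  ring

lemma nonneg_Icc_of_pos_Ioo {f : ℝ → ℝ} (hf : Continuous f) {a b : ℝ} (hab : a < b)
    (h : ∀ x ∈ Set.Ioo a b, 0 < f x) : ∀ x ∈ Set.Icc a b, 0 ≤ f x := by
  rw [← closure_Ioo hab.ne]
  exact fun x hx => closure_minimal (fun y hy => (h y hy).le)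
    (isClosed_le continuous_const hf) hx

lemma integral_abs_of_nonneg_mul {f : ℝ → ℝ} {a b σ : ℝ} (hab : a ≤ b) (hσ : |σ| = 1)
    (h : ∀ x ∈ Set.Icc a b, 0 ≤ σ * f x) :
    ∫ v in a..b, |f v| = σ * ∫ v in a..b, f v := by
  rw [← intervalIntegral.integral_const_mul]
  refine intervalIntegral.integral_congr fun x hx => ?_
  rw [Set.uIcc_of_le hab] at hx
  rw [← abs_of_nonneg (h x hx), abs_mul, hσ, one_mul]

theorem integral_abs_normBernoulli_sub_bestConst (n : ℕ) (hn : 1 ≤ n) :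
    ∫ v in (0 : ℝ)..1, |normBernoulli n v - bestConst n| = (favardConst n : ℝ) := by
  rw [favardConst_eq_abs_halfEuler]
  have hcont : Continuous fun v => |normBernoulli n v - bestConst n| :=
    ((continuous_normBernoulli n).sub continuous_const).abs
  have hpow : ∀ k : ℕ, |(-1 : ℝ) ^ k| = 1 := fun k => by simp
  -- The integral is nonnegative, so it is enough to find it up to sign.
  suffices h : ∃ σ : ℝ, |σ| = 1 ∧ ∫ v in (0 : ℝ)..1, |normBernoulli n v - bestConst n| =
      σ * halfEuler n (extremalPoint n) by
    obtain ⟨σ, hσ, h⟩ := h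
    have h0 : 0 ≤ ∫ v in (0 : ℝ)..1, |normBernoulli n v - bestConst n| :=
      intervalIntegral.integral_nonneg zero_le_one fun _ _ => abs_nonneg _
    rw [← abs_of_nonneg h0, h, abs_mul, hσ, one_mul]
  rcases Nat.even_or_odd n with he | ho
  · have hno : ¬ Odd n := Nat.not_odd_iff_even.2 he
    obtain ⟨k, hk⟩ : ∃ k, n = 2 * k + 2 := by
      obtain ⟨r, hr⟩ := he
      exact ⟨r - 1, by omega⟩
    rw [integral_eq_two_mul_of_symm hcont fun v => by
      simp only [normBernoulli_one_sub, he.neg_one_pow, one_mul]]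
    rw [← intervalIntegral.integral_add_adjacent_intervals (hcont.intervalIntegrable 0 (1 / 4))
      (hcont.intervalIntegrable (1 / 4) (1 / 2))]
    have hmono := strictMonoOn_normBernoulli_of_pos (normBernoulli_odd_sign k)
    rw [show 2 * k + 1 + 1 = n by omega] at hmono
    have hc : bestConst n = normBernoulli n (1 / 4) := if_neg hno
    have hq : (1 / 4 : ℝ) ∈ Set.Icc (0 : ℝ) (1 / 2) := by norm_num
    have hint : ∀ a b : ℝ, ∫ v in a..b, (normBernoulli n v - bestConst n) =
        normBernoulli (n + 1) b - normBernoulli (n + 1) a - (b - a) * bestConst n := by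
      intro a b
      rw [intervalIntegral.integral_sub ((continuous_normBernoulli n).intervalIntegrable _ _)
        (continuous_const.intervalIntegrable _ _), integral_normBernoulli,
        intervalIntegral.integral_const, smul_eq_mul]
    rw [integral_abs_of_nonneg_mul (σ := (-1) ^ (k + 2)) (by norm_num) (hpow _) fun x hx => by
        have := hmono.monotoneOn ⟨hx.1, by linarith [hx.2]⟩ hq hx.2
        rw [hc, pow_succ]
        linarith,
      integral_abs_of_nonneg_mul (σ := (-1) ^ (k + 1)) (by norm_num) (hpow _) fun x hx => by
        have := hmono.monotoneOn hq ⟨by linarith [hx.1], hx.2⟩ hx.1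
        rw [hc]
        linarith, hint, hint]
    refine ⟨(-1) ^ (k + 1), hpow _, ?_⟩
    have hodd : Odd (n + 1) := he.add_one
    have h34 := normBernoulli_one_sub (n + 1) (1 / 4)
    rw [hodd.neg_one_pow] at h34
    rw [extremalPoint, if_neg hno, halfEuler, normBernoulli_odd_zero hodd (by omega),
      normBernoulli_odd_half hodd, show (1 / 4 : ℝ) + 1 / 2 = 1 - 1 / 4 by norm_num, h34, pow_succ]
    ring
  · obtain ⟨k, rfl⟩ := ho
    have ho : Odd (2 * k + 1) := ⟨k, rfl⟩
    rw [integral_eq_two_mul_of_symm hcont fun v => by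
      rw [bestConst, if_pos ho, normBernoulli_one_sub, sub_zero, sub_zero, abs_mul, hpow, one_mul]]
    refine ⟨(-1) ^ (k + 1), hpow _, ?_⟩
    rw [bestConst, if_pos ho, extremalPoint, if_pos ho, halfEuler, zero_add]
    simp only [sub_zero]
    rw [integral_abs_of_nonneg_mul (by norm_num) (hpow (k + 1)) (nonneg_Icc_of_pos_Ioo
      (continuous_const.mul (continuous_normBernoulli _)) (by norm_num)
      (normBernoulli_odd_sign k)), integral_normBernoulli]
    ring

lemma favardConst_pos (n : ℕ) (hn : 1 ≤ n) : 0 < (favardConst n : ℝ) := by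
  rw [← integral_abs_normBernoulli_sub_bestConst n hn]
  obtain ⟨m, rfl⟩ : ∃ m, n = m + 1 := ⟨n - 1, by omega⟩
  obtain ⟨v, hv, hne⟩ := exists_normBernoulli_ne m (bestConst (m + 1)) isOpen_Ioo
    (Set.nonempty_Ioo.2 (zero_lt_one (α := ℝ)))
  exact intervalIntegral.integral_pos zero_lt_one
    ((continuous_normBernoulli _).sub continuous_const).abs.continuousOn
    (fun _ _ => abs_nonneg _) ⟨v, ⟨hv.1.le, hv.2.le⟩, abs_pos.2 (sub_ne_zero.2 hne)⟩

/-! ### Oscillation of a periodic function and bounds for its highest derivative -/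

/-- The Bernoulli polynomial rescaled to `[t, t + T]`: `T` times the kernel which recovers a
`T`-periodic function, up to its mean and a sign, from its `n`-th derivative. -/
noncomputable def periodKernel (n : ℕ) (T t v : ℝ) : ℝ := T ^ n * normBernoulli n ((v - t) / T)

lemma continuous_periodKernel (n : ℕ) (T t : ℝ) : Continuous (periodKernel n T t) :=
  continuous_const.mul ((continuous_normBernoulli n).comp (by fun_prop))

lemma hasDerivAt_periodKernel (n : ℕ) {T : ℝ} (hT : 0 < T) (t v : ℝ) :
    HasDerivAt (periodKernel (n + 1) T t) (periodKernel n T t v) v := by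
  have h1 : HasDerivAt (fun v : ℝ => (v - t) / T) (1 / T) v :=
    ((hasDerivAt_id v).sub_const t).div_const T
  have h2 := ((hasDerivAt_normBernoulli n ((v - t) / T)).comp v h1).const_mul (T ^ (n + 1))
  convert! h2 using 1
  rw [periodKernel, pow_succ]
  field_simp

lemma absolutelyContinuousOnInterval_periodKernel (n : ℕ) (T t a b : ℝ) :
    AbsolutelyContinuousOnInterval (periodKernel n T t) a b := by
  refine ContDiffOn.absolutelyContinuousOnInterval (ContDiff.contDiffOn ?_)
  unfold periodKernel normBernoulli
  have h : ContDiff ℝ 1 (bernoulliFun n) := (contDiff_bernoulliFun n).of_le le_top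
  exact contDiff_const.mul ((h.comp ((contDiff_id.sub contDiff_const).div_const T)).div_const _)

lemma periodic_iteratedDeriv {x : ℝ → ℝ} {T : ℝ} (hper : Function.Periodic x T) (n : ℕ) :
    Function.Periodic (iteratedDeriv n x) T := by
  intro t
  have h := congrFun (iteratedDeriv_comp_add_const n x T) t
  rw [← h]
  congr 1
  exact funext hper

lemma integral_periodKernel_mul_deriv {n : ℕ} {T : ℝ} (hT : 0 < T) {z : ℝ → ℝ}
    (hac : ∀ a b, AbsolutelyContinuousOnInterval z a b) (hper : Function.Periodic z T) (t : ℝ) :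
    ∫ v in t..t + T, periodKernel (n + 1) T t v * deriv z v =
      (if n = 0 then T else 0) * z t - ∫ v in t..t + T, periodKernel n T t v * z v := by
  rw [(absolutelyContinuousOnInterval_periodKernel (n + 1) T t t
    (t + T)).integral_mul_deriv_eq_deriv_mul (hac t (t + T)), hper t]
  have hd : deriv (periodKernel (n + 1) T t) = periodKernel n T t :=
    funext fun v => (hasDerivAt_periodKernel n hT t v).deriv
  rw [hd]
  congr 1
  have h1 : (t + T - t) / T = 1 := by field_simp; ring
  have h0 : (t - t) / T = 0 := by simp
  rw [periodKernel, periodKernel, h1, h0]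
  split_ifs with hn
  · subst hn
    rw [Nat.zero_add, normBernoulli_one, normBernoulli_one]
    ring
  · rw [normBernoulli_eval_one (by omega)]
    ring

/-- A periodic function is recovered from its highest derivative by integration against the
Bernoulli kernel. -/
lemma integral_periodKernel_mul_iteratedDeriv {n : ℕ} {T : ℝ} (hT : 0 < T) {x : ℝ → ℝ}
    (hx : ContDiff ℝ n x) (hac : ∀ a b, AbsolutelyContinuousOnInterval (iteratedDeriv n x) a b)
    (hper : Function.Periodic x T) (t : ℝ) :
    ∫ v in t..t + T, periodKernel (n + 1) T t v * iteratedDeriv (n + 1) x v =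
      (-1) ^ n * (T * x t - ∫ v in t..t + T, x v) := by
  induction n with
  | zero =>
    rw [iteratedDeriv_zero] at hac
    rw [iteratedDeriv_succ, iteratedDeriv_zero, integral_periodKernel_mul_deriv hT hac hper]
    simp [periodKernel, normBernoulli_zero]
  | succ n ih =>
    rw [iteratedDeriv_succ, integral_periodKernel_mul_deriv hT hac (periodic_iteratedDeriv hper _),
      ih (hx.of_le (by exact_mod_cast Nat.le_succ n)) fun a b => ?_, pow_succ]
    · simp
    · refine ContDiffOn.absolutelyContinuousOnInterval (ContDiff.contDiffOn ?_)
      exact (contDiff_nat_succ_iff_contDiff_one_iteratedDeriv.1 hx).2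

lemma integral_deriv_period {T : ℝ} {z : ℝ → ℝ}
    (hac : ∀ a b, AbsolutelyContinuousOnInterval z a b) (hper : Function.Periodic z T) (t : ℝ) :
    ∫ v in t..t + T, deriv z v = 0 := by
  rw [(hac t (t + T)).integral_deriv_eq_sub, hper t, sub_self]

lemma integral_comp_sub_div_period {T : ℝ} (hT : 0 < T) (t : ℝ) (f : ℝ → ℝ) :
    ∫ v in t..t + T, f ((v - t) / T) = T * ∫ v in (0 : ℝ)..1, f v := by
  have h := intervalIntegral.integral_comp_sub_right (a := t) (b := t + T) (fun v => f (v / T)) t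
  rw [h, intervalIntegral.integral_comp_div _ hT.ne', sub_self, add_sub_cancel_left, zero_div,
    div_self hT.ne', smul_eq_mul]

/-- The optimally centred kernel integrated against the centred highest derivative. Its constant
term `d * C * T` does not depend on `t`, so it cancels in differences `x t - x s`. -/
lemma integral_centred_periodKernel {n : ℕ} {T : ℝ} (hT : 0 < T) {x : ℝ → ℝ}
    (hx : ContDiff ℝ n x) (hac : ∀ a b, AbsolutelyContinuousOnInterval (iteratedDeriv n x) a b)
    (hper : Function.Periodic x T) (C d t : ℝ) :
    ∫ v in t..t + T, (periodKernel (n + 1) T t v - C) * (iteratedDeriv (n + 1) x v - d) =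
      (-1) ^ n * (T * x t - ∫ v in (0 : ℝ)..T, x v) + d * C * T := by
  have hg : IntervalIntegrable (iteratedDeriv (n + 1) x) volume t (t + T) := by
    rw [iteratedDeriv_succ]
    exact (hac t (t + T)).intervalIntegrable_deriv
  have hk := (continuous_periodKernel (n + 1) T t)
  have hg0 : ∫ v in t..t + T, iteratedDeriv (n + 1) x v = 0 := by
    rw [iteratedDeriv_succ]
    exact integral_deriv_period hac (periodic_iteratedDeriv hper n) t
  have hk0 : ∫ v in t..t + T, periodKernel (n + 1) T t v = 0 := by
    unfold periodKernel
    rw [intervalIntegral.integral_const_mul,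
      integral_comp_sub_div_period hT t (normBernoulli (n + 1)), integral_normBernoulli,
      normBernoulli_eval_one (by omega)]
    ring
  have hxI : ∫ v in t..t + T, x v = ∫ v in (0 : ℝ)..T, x v := by
    rw [hper.intervalIntegral_add_eq t 0, zero_add]
  have hsplit : (fun v => (periodKernel (n + 1) T t v - C) * (iteratedDeriv (n + 1) x v - d)) =
      fun v => (periodKernel (n + 1) T t v * iteratedDeriv (n + 1) x v -
        C * iteratedDeriv (n + 1) x v) - (d * periodKernel (n + 1) T t v - d * C) := by
    funext v
    ring
  have hkg : IntervalIntegrable (fun v => periodKernel (n + 1) T t v * iteratedDeriv (n + 1) x v)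
      volume t (t + T) := hg.continuousOn_mul hk.continuousOn
  have hdk : IntervalIntegrable (fun v => d * periodKernel (n + 1) T t v)
      volume t (t + T) := (continuous_const.mul hk).intervalIntegrable _ _
  rw [hsplit, intervalIntegral.integral_sub (hkg.sub (hg.const_mul C))
      (hdk.sub (continuous_const.intervalIntegrable _ _)),
    intervalIntegral.integral_sub hkg (hg.const_mul C),
    intervalIntegral.integral_sub hdk (continuous_const.intervalIntegrable _ _),
    intervalIntegral.integral_const_mul, intervalIntegral.integral_const_mul, hg0, hk0,
    intervalIntegral.integral_const, integral_periodKernel_mul_iteratedDeriv hT hx hac hper, hxI]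
  simp only [smul_eq_mul]
  ring

lemma integral_abs_periodKernel_sub {n : ℕ} (hn : 1 ≤ n) {T : ℝ} (hT : 0 < T) (t : ℝ) :
    ∫ v in t..t + T, |periodKernel n T t v - T ^ n * bestConst n| =
      (favardConst n : ℝ) * T ^ (n + 1) := by
  have h : (fun v => |periodKernel n T t v - T ^ n * bestConst n|) =
      fun v => T ^ n * |normBernoulli n ((v - t) / T) - bestConst n| := by
    funext v
    rw [periodKernel, ← mul_sub, abs_mul, abs_of_pos (pow_pos hT n)]
  rw [h, intervalIntegral.integral_const_mul,
    integral_comp_sub_div_period hT t (fun v => |normBernoulli n v - bestConst n|),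
    integral_abs_normBernoulli_sub_bestConst n hn]
  ring

/-- The Bohr-Favard inequality for oscillations. -/
theorem sub_le_of_ae_iteratedDeriv_mem {n : ℕ} {T : ℝ} (hT : 0 < T) {x : ℝ → ℝ}
    (hx : ContDiff ℝ n x) (hac : ∀ a b, AbsolutelyContinuousOnInterval (iteratedDeriv n x) a b)
    (hper : Function.Periodic x T) {d r : ℝ}
    (hbd : ∀ᵐ v : ℝ, |iteratedDeriv (n + 1) x v - d| ≤ r) (t s : ℝ) :
    x t - x s ≤ 2 * r * (favardConst (n + 1) : ℝ) * T ^ (n + 1) := by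
  set C : ℝ := T ^ (n + 1) * bestConst (n + 1) with hC
  have key : ∀ t, |(-1) ^ n * (T * x t - ∫ v in (0 : ℝ)..T, x v) + d * C * T| ≤
      r * ((favardConst (n + 1) : ℝ) * T ^ (n + 1 + 1)) := by
    intro t
    rw [← integral_centred_periodKernel hT hx hac hper, ← integral_abs_periodKernel_sub
      (Nat.le_add_left 1 n) hT t, ← Real.norm_eq_abs, ← intervalIntegral.integral_const_mul]
    refine intervalIntegral.norm_integral_le_of_norm_le (by linarith) ?_
      ((((continuous_periodKernel _ _ _).sub continuous_const).abs.const_mul r).intervalIntegrable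
        _ _)
    filter_upwards [hbd] with v hv _
    rw [Real.norm_eq_abs, abs_mul, mul_comm]
    exact mul_le_mul_of_nonneg_right hv (abs_nonneg _)
  have h := (abs_sub _ _).trans (add_le_add (key t) (key s))
  have e : (-1) ^ n * (T * x t - ∫ v in (0 : ℝ)..T, x v) + d * C * T -
      ((-1) ^ n * (T * x s - ∫ v in (0 : ℝ)..T, x v) + d * C * T) =
      (-1) ^ n * (T * (x t - x s)) := by ring
  rw [e, abs_mul, abs_pow, abs_neg, abs_one, one_pow, one_mul, abs_mul, abs_of_pos hT] at h
  refine (le_abs_self _).trans (le_of_mul_le_mul_left (h.trans (le_of_eq ?_)) hT)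
  ring

/-- The Bohr-Favard inequality is strict when the highest derivative is continuous and not constant:
near a point where that derivative takes its mid-value the estimate of the integrand has slack. -/
theorem sub_lt_of_iteratedDeriv_mem {n : ℕ} {T : ℝ} (hT : 0 < T) {x : ℝ → ℝ}
    (hx : ContDiff ℝ (n + 1 : ℕ) x) (hper : Function.Periodic x T) {d r : ℝ} (hr : 0 < r)
    (hbd : ∀ v : ℝ, |iteratedDeriv (n + 1) x v - d| ≤ r)
    (hmid : ∃ v : ℝ, iteratedDeriv (n + 1) x v = d) (t s : ℝ) :
    x t - x s < 2 * r * (favardConst (n + 1) : ℝ) * T ^ (n + 1) := by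
  have hx1 : ContDiff ℝ n x := hx.of_le (by exact_mod_cast Nat.le_succ n)
  have hac : ∀ a b, AbsolutelyContinuousOnInterval (iteratedDeriv n x) a b := fun a b =>
    ((contDiff_nat_succ_iff_contDiff_one_iteratedDeriv.1
      hx).2.contDiffOn).absolutelyContinuousOnInterval
  have hg : Continuous (iteratedDeriv (n + 1) x) := hx.continuous_iteratedDeriv' _
  set C : ℝ := T ^ (n + 1) * bestConst (n + 1) with hC
  have key : ∀ t, |(-1) ^ n * (T * x t - ∫ v in (0 : ℝ)..T, x v) + d * C * T| <
      r * ((favardConst (n + 1) : ℝ) * T ^ (n + 1 + 1)) := by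
    intro t
    rw [← integral_centred_periodKernel hT hx1 hac hper, ← integral_abs_periodKernel_sub
      (Nat.le_add_left 1 n) hT t, ← intervalIntegral.integral_const_mul]
    have hk : Continuous fun v => periodKernel (n + 1) T t v - C :=
      (continuous_periodKernel _ _ _).sub continuous_const
    refine (intervalIntegral.abs_integral_le_integral_abs (by linarith)).trans_lt
      (intervalIntegral.integral_lt_integral_of_continuousOn_of_le_of_exists_lt (by linarith)
        (hk.mul (hg.sub continuous_const)).abs.continuousOn
        (hk.abs.const_mul r).continuousOn ?_ ?_)
    · intro v _
      rw [abs_mul, mul_comm]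
      exact mul_le_mul_of_nonneg_right (hbd v) (abs_nonneg _)
    · obtain ⟨v₀, hv₀⟩ := hmid
      obtain ⟨v₁, hv₁, he⟩ := (periodic_iteratedDeriv hper (n + 1)).exists_mem_Ico hT v₀ t
      have hU : IsOpen {v | |iteratedDeriv (n + 1) x v - d| < r} :=
        isOpen_lt (hg.sub continuous_const).abs continuous_const
      have hne : ({v | |iteratedDeriv (n + 1) x v - d| < r} ∩ Set.Ioo t (t + T)).Nonempty := by
        have hcl : v₁ ∈ closure (Set.Ioo t (t + T)) := by
          rw [closure_Ioo (by linarith)]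
          exact ⟨hv₁.1, hv₁.2.le⟩
        refine mem_closure_iff.1 hcl _ hU ?_
        simp [← he, hv₀, hr]
      -- Pull the open set back to the argument of the unscaled polynomial.
      obtain ⟨w, hw, hwne⟩ := exists_normBernoulli_ne n (bestConst (n + 1))
        (U := (fun w => T * w + t) ⁻¹' ({v | |iteratedDeriv (n + 1) x v - d| < r} ∩
          Set.Ioo t (t + T))) ((hU.inter isOpen_Ioo).preimage (by fun_prop)) (by
            obtain ⟨v, hv⟩ := hne
            refine ⟨(v - t) / T, ?_⟩
            rw [Set.mem_preimage, mul_div_cancel₀ _ hT.ne', sub_add_cancel]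
            exact hv)
      refine ⟨T * w + t, ⟨hw.2.1.le, hw.2.2.le⟩, ?_⟩
      have hkne : periodKernel (n + 1) T t (T * w + t) - C ≠ 0 := by
        rw [periodKernel, hC, ← mul_sub, add_sub_cancel_right, mul_div_cancel_left₀ _ hT.ne']
        exact mul_ne_zero (pow_pos hT _).ne' (sub_ne_zero.2 hwne)
      rw [abs_mul, mul_comm]
      exact mul_lt_mul_of_pos_right hw.1 (abs_pos.2 hkne)
  have h := (abs_sub _ _).trans_lt (add_lt_add (key t) (key s))
  have e : (-1) ^ n * (T * x t - ∫ v in (0 : ℝ)..T, x v) + d * C * T -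
      ((-1) ^ n * (T * x s - ∫ v in (0 : ℝ)..T, x v) + d * C * T) =
      (-1) ^ n * (T * (x t - x s)) := by ring
  rw [e, abs_mul, abs_pow, abs_neg, abs_one, one_pow, one_mul, abs_mul, abs_of_pos hT] at h
  refine (le_abs_self _).trans_lt (lt_of_mul_lt_mul_left (h.trans_eq ?_) hT.le)
  ring

/-! ### Necessary conditions for non-constant periodic solutions -/

lemma Function.Periodic.exists_isMinMax {x : ℝ → ℝ} {T : ℝ} (hT : 0 < T)
    (hper : Function.Periodic x T) (hc : Continuous x) : ∃ a b, ∀ t, x t ∈ Set.Icc (x a) (x b) := by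
  obtain ⟨a, -, ha⟩ := isCompact_Icc.exists_isMinOn (Set.nonempty_Icc.2 hT.le) hc.continuousOn
  obtain ⟨b, -, hb⟩ := isCompact_Icc.exists_isMaxOn (Set.nonempty_Icc.2 hT.le) hc.continuousOn
  refine ⟨a, b, fun t => ?_⟩
  obtain ⟨s, hs, he⟩ := hper.exists_mem_Ico₀ hT t
  rw [he]
  exact ⟨ha ⟨hs.1, hs.2.le⟩, hb ⟨hs.1, hs.2.le⟩⟩

lemma sSup_image_mem_Icc {x : ℝ → ℝ} {τ θ m M : ℝ} (h : τ ≤ θ) (hx : ∀ t, x t ∈ Set.Icc m M) :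
    sSup (x '' Set.Icc τ θ) ∈ Set.Icc m M := by
  have hne : (x '' Set.Icc τ θ).Nonempty := (Set.nonempty_Icc.2 h).image x
  have hM : ∀ y ∈ x '' Set.Icc τ θ, y ≤ M := by
    rintro _ ⟨t, -, rfl⟩
    exact (hx t).2
  refine ⟨?_, csSup_le hne hM⟩
  exact (hx τ).1.trans (le_csSup ⟨M, hM⟩ ⟨τ, ⟨le_rfl, h⟩, rfl⟩)

lemma IsNonconstantPeriodicMaximaSolution.exists_range {n : ℕ} {T : ℝ} {q τ θ x : ℝ → ℝ}
    (hT : 0 < T) (hle : ∀ t, τ t ≤ θ t) (h : IsNonconstantPeriodicMaximaSolution n T q τ θ x) :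
    ∃ a b, x a < x b ∧ (∀ t, x t ∈ Set.Icc (x a) (x b)) ∧
      ∀ t, sSup (x '' Set.Icc (τ t) (θ t)) ∈ Set.Icc (x a) (x b) := by
  obtain ⟨a, b, hab⟩ := h.periodic.exists_isMinMax hT h.solution.contDiff.continuous
  refine ⟨a, b, (hab a).2.lt_of_ne fun he => h.nonconstant ⟨x a, fun t => ?_⟩, hab,
    fun t => sSup_image_mem_Icc (hle t) hab⟩
  exact le_antisymm ((hab t).2.trans he.ge) (hab t).1

lemma abs_sub_midpoint_le {m M y : ℝ} (hy : y ∈ Set.Icc m M) : |y - (m + M) / 2| ≤ (M - m) / 2 := by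
  rw [abs_le]
  constructor <;> linarith [hy.1, hy.2]

theorem one_div_favardConst_le {n : ℕ} {T L : ℝ} {τ θ x : ℝ → ℝ} (hn : 1 ≤ n) (hT : 0 < T)
    (hle : ∀ t, τ t ≤ θ t) (h : IsNonconstantPeriodicMaximaSolution n T (fun _ => L) τ θ x) :
    1 / (favardConst n : ℝ) ≤ |L| * T ^ n := by
  obtain ⟨a, b, hab, -, hy⟩ := h.exists_range hT hle
  obtain ⟨k, rfl⟩ : ∃ k, n = k + 1 := ⟨n - 1, by omega⟩
  have hbd : ∀ᵐ v : ℝ, |iteratedDeriv (k + 1) x v - L * ((x a + x b) / 2)| ≤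
      |L| * ((x b - x a) / 2) := by
    filter_upwards [h.solution.equation] with v hv
    rw [hv, ← mul_sub, abs_mul]
    exact mul_le_mul_of_nonneg_left (abs_sub_midpoint_le (hy v)) (abs_nonneg L)
  have hosc := sub_le_of_ae_iteratedDeriv_mem (n := k) hT (by exact_mod_cast h.solution.contDiff)
    h.solution.absolutelyContinuous h.periodic hbd b a
  rw [div_le_iff₀ (favardConst_pos _ hn)]
  have hpos : 0 < x b - x a := sub_pos.2 hab
  refine le_of_mul_le_mul_left ?_ hpos
  linarith

/-- The first-order estimate. Over the part of the period from `s` to `t` the function rises by at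
most `M` times the mass of `p`, over the rest it falls by at most `-m` times the mass of `p`; the
weights `-m` and `M` combine the two bounds, and `4 M (-m) ≤ (M - m)²`. -/
theorem sub_le_quarter_mul_integral {T m M : ℝ} {p y z : ℝ → ℝ} (hT : 0 < T)
    (hp : IsPositivePeriodicCoeff T p)
    (hac : ∀ a b, AbsolutelyContinuousOnInterval z a b) (hper : Function.Periodic z T)
    (hz : ∀ᵐ v : ℝ, deriv z v = p v * y v) (hy : ∀ v, y v ∈ Set.Icc m M) (hmM : m < M) (t s : ℝ) :
    z t - z s ≤ (M - m) / 4 * ∫ v in (0 : ℝ)..T, p v := by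
  have hpi : ∀ a b, IntervalIntegrable p volume a b := fun a b =>
    (hp.locallyIntegrable.integrableOn_isCompact isCompact_uIcc).intervalIntegrable
  have hP : ∀ s, ∫ v in s..s + T, p v = ∫ v in (0 : ℝ)..T, p v := fun s => by
    rw [hp.periodic.intervalIntegral_add_eq s 0, zero_add]
  have hPpos : 0 < ∫ v in (0 : ℝ)..T, p v :=
    intervalIntegral.intervalIntegral_pos_of_pos (hpi _ _) hp.pos hT
  have hup : ∀ a b, a ≤ b → z b - z a ≤ M * ∫ v in a..b, p v := by
    intro a b hab
    rw [← (hac a b).integral_deriv_eq_sub, ← intervalIntegral.integral_const_mul]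
    refine intervalIntegral.integral_mono_ae hab (hac a b).intervalIntegrable_deriv
      ((hpi a b).const_mul M) ?_
    filter_upwards [hz] with v hv
    rw [hv, mul_comm]
    exact mul_le_mul_of_nonneg_right (hy v).2 (hp.pos v).le
  have hlow : ∀ a b, a ≤ b → m * ∫ v in a..b, p v ≤ z b - z a := by
    intro a b hab
    rw [← (hac a b).integral_deriv_eq_sub, ← intervalIntegral.integral_const_mul]
    refine intervalIntegral.integral_mono_ae hab ((hpi a b).const_mul m)
      (hac a b).intervalIntegrable_deriv ?_
    filter_upwards [hz] with v hv
    rw [hv, mul_comm (p v)]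
    exact mul_le_mul_of_nonneg_right (hy v).1 (hp.pos v).le
  have hM : 0 ≤ M := by
    have h := hup s (s + T) (by linarith)
    rw [hper s, sub_self, hP] at h
    exact nonneg_of_mul_nonneg_left h hPpos
  have hm : m ≤ 0 := by
    have h := hlow s (s + T) (by linarith)
    rw [hper s, sub_self, hP] at h
    exact nonpos_of_mul_nonpos_left h hPpos
  obtain ⟨r, hr, he⟩ := hper.exists_mem_Ico hT t s
  rw [he]
  have h1 := hup s r hr.1
  have h2 := hlow r (s + T) hr.2.le
  rw [hper s] at h2
  have h3 := intervalIntegral.integral_add_adjacent_intervals (hpi s r) (hpi r (s + T))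
  rw [hP] at h3
  rw [← h3] at hPpos ⊢
  have hd : 0 < M - m := sub_pos.2 hmM
  have h4 := mul_le_mul_of_nonneg_left h1 (neg_nonneg.2 hm)
  have h5 := mul_le_mul_of_nonneg_left h2 hM
  refine le_of_mul_le_mul_left ?_ hd
  have h6 := mul_nonneg (sq_nonneg (M + m)) hPpos.le
  linarith

theorem four_le_integral {T : ℝ} {p τ θ x : ℝ → ℝ} (hT : 0 < T) (hle : ∀ t, τ t ≤ θ t)
    (hp : IsPositivePeriodicCoeff T p) (h : IsNonconstantPeriodicMaximaSolution 1 T p τ θ x) :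
    4 ≤ ∫ t in (0 : ℝ)..T, p t := by
  obtain ⟨a, b, hab, -, hy⟩ := h.exists_range hT hle
  have hac := h.solution.absolutelyContinuous
  have hz := h.solution.equation
  simp only [Nat.sub_self, iteratedDeriv_zero] at hac
  simp only [iteratedDeriv_one] at hz
  have hosc := sub_le_quarter_mul_integral hT hp hac h.periodic hz hy hab b a
  have hpos : 0 < x b - x a := sub_pos.2 hab
  refine le_of_mul_le_mul_left ?_ hpos
  linarith

theorem four_div_favardConst_lt {n : ℕ} {T : ℝ} {p τ θ x : ℝ → ℝ} (hn : 2 ≤ n) (hT : 0 < T)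
    (hle : ∀ t, τ t ≤ θ t) (hp : IsPositivePeriodicCoeff T p)
    (h : IsNonconstantPeriodicMaximaSolution n T p τ θ x) :
    4 / (favardConst (n - 1) : ℝ) < (∫ t in (0 : ℝ)..T, p t) * T ^ (n - 1) := by
  obtain ⟨a, b, hab, -, hy⟩ := h.exists_range hT hle
  obtain ⟨k, rfl⟩ : ∃ k, n = k + 2 := ⟨n - 2, by omega⟩
  rw [show k + 2 - 1 = k + 1 by omega]
  have hx : ContDiff ℝ (k + 1 : ℕ) x := by exact_mod_cast h.solution.contDiff
  have hac : ∀ c d, AbsolutelyContinuousOnInterval (iteratedDeriv (k + 1) x) c d :=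
    h.solution.absolutelyContinuous
  have hz := h.solution.equation
  rw [show k + 2 = k + 1 + 1 by rfl, iteratedDeriv_succ] at hz
  have hper := periodic_iteratedDeriv h.periodic (k + 1)
  have hcont : Continuous (iteratedDeriv (k + 1) x) := hx.continuous_iteratedDeriv' _
  obtain ⟨c, d, hcd⟩ := hper.exists_isMinMax hT hcont
  have hosc := sub_le_quarter_mul_integral hT hp hac hper hz hy hab d c
  have hpos : 0 < x b - x a := sub_pos.2 hab
  have hbd : ∀ v, |iteratedDeriv (k + 1) x v -
      (iteratedDeriv (k + 1) x c + iteratedDeriv (k + 1) x d) / 2| ≤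
      (iteratedDeriv (k + 1) x d - iteratedDeriv (k + 1) x c) / 2 := fun v =>
    abs_sub_midpoint_le (hcd v)
  have hcd' : 0 < (iteratedDeriv (k + 1) x d - iteratedDeriv (k + 1) x c) / 2 := by
    by_contra hneg
    -- A function with constant highest derivative has no oscillation.
    have h0 := sub_le_of_ae_iteratedDeriv_mem (n := k) hT
      (hx.of_le (by exact_mod_cast Nat.le_succ k))
      (fun e f => ((contDiff_nat_succ_iff_contDiff_one_iteratedDeriv.1
        hx).2.contDiffOn).absolutelyContinuousOnInterval) h.periodic
      (Filter.Eventually.of_forall hbd) b a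
    have hK := mul_pos (favardConst_pos (k + 1) (by omega)) (pow_pos hT (k + 1))
    have hle0 := mul_nonpos_of_nonpos_of_nonneg (not_lt.1 hneg) hK.le
    linarith
  have hlt := sub_lt_of_iteratedDeriv_mem hT hx h.periodic hcd' hbd
    (mem_range_of_exists_le_of_exists_ge hcont ⟨c, by linarith⟩ ⟨d, by linarith⟩) b a
  have hK := favardConst_pos (k + 1) (by omega)
  rw [div_lt_iff₀ hK]
  refine lt_of_mul_lt_mul_left ?_ hpos.le
  have hKT := mul_pos hK (pow_pos hT (k + 1))
  have h1 := mul_le_mul_of_nonneg_right hosc hKT.le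
  linarith

/-! ### Perfect splines -/

/-- The square wave of period `T`: `1` on the first half of each period, `-1` on the second. -/
noncomputable def squareWave (T t : ℝ) : ℝ := if Even ⌊2 * t / T⌋ then 1 else -1

lemma squareWave_eq (T t : ℝ) : squareWave T t = 1 ∨ squareWave T t = -1 := by
  unfold squareWave
  split_ifs <;> simp

lemma measurable_squareWave (T : ℝ) : Measurable (squareWave T) := by
  have h : Measurable fun t : ℝ => ⌊2 * t / T⌋ :=
    Int.measurable_floor.comp ((measurable_const.mul measurable_id).div_const T)
  exact Measurable.ite (h (MeasurableSet.of_discrete (s := {k : ℤ | Even k}))) measurable_const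
    measurable_const

lemma squareWave_antiperiodic {T : ℝ} (hT : 0 < T) :
    Function.Antiperiodic (squareWave T) (T / 2) := by
  intro t
  have h : 2 * (t + T / 2) / T = 2 * t / T + 1 := by field_simp
  unfold squareWave
  simp only [h, Int.floor_add_one, Int.even_add_one]
  by_cases h1 : Even ⌊2 * t / T⌋ <;> simp [h1]

lemma squareWave_of_mem {T t : ℝ} (hT : 0 < T) (ht : t ∈ Set.Ico 0 (T / 2)) :
    squareWave T t = 1 := by
  have h : ⌊2 * t / T⌋ = 0 := by
    rw [Int.floor_eq_zero_iff]
    exact ⟨by have := ht.1; positivity, (div_lt_one hT).2 (by linarith [ht.2])⟩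
  rw [squareWave, h, if_pos (by simp)]

lemma locallyIntegrable_of_bound {f : ℝ → ℝ} (hf : Measurable f) {C : ℝ} (hC : ∀ t, |f t| ≤ C) :
    LocallyIntegrable f volume :=
  (locallyIntegrable_const C).mono hf.aestronglyMeasurable
    (Filter.Eventually.of_forall fun t => (hC t).trans (le_abs_self C))

lemma locallyIntegrable_squareWave (T : ℝ) : LocallyIntegrable (squareWave T) volume :=
  locallyIntegrable_of_bound (measurable_squareWave T) (C := 1) fun t => by
    rcases squareWave_eq T t with h | h <;> simp [h]

/-- The Euler perfect spline of degree `n` and period `T`: the `n`-fold primitive of the square wave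
which keeps its antiperiodicity, obtained at each step by centring the primitive. -/
noncomputable def perfectSpline (T : ℝ) : ℕ → ℝ → ℝ
  | 0 => squareWave T
  | n + 1 => fun t =>
      (∫ v in (0 : ℝ)..t, perfectSpline T n v) - (∫ v in (0 : ℝ)..(T / 2), perfectSpline T n v) / 2

lemma intervalIntegrable_perfectSpline (T : ℝ) (n : ℕ) (a b : ℝ) :
    IntervalIntegrable (perfectSpline T n) volume a b := by
  induction n generalizing a b with
  | zero =>
    exact ((locallyIntegrable_squareWave T).integrableOn_isCompact
      isCompact_uIcc).intervalIntegrable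
  | succ n ih =>
    exact ((intervalIntegral.continuous_primitive ih 0).sub continuous_const).intervalIntegrable _ _

lemma continuous_perfectSpline (T : ℝ) (n : ℕ) : Continuous (perfectSpline T (n + 1)) :=
  (intervalIntegral.continuous_primitive (intervalIntegrable_perfectSpline T n) 0).sub
    continuous_const

lemma hasDerivAt_perfectSpline (T : ℝ) (n : ℕ) (t : ℝ) :
    HasDerivAt (perfectSpline T (n + 2)) (perfectSpline T (n + 1) t) t :=
  (((continuous_perfectSpline T n).integral_hasStrictDerivAt 0 t).hasDerivAt).sub_const _

lemma ae_hasDerivAt_perfectSpline_one (T : ℝ) :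
    ∀ᵐ t : ℝ, HasDerivAt (perfectSpline T 1) (squareWave T t) t := by
  filter_upwards [LocallyIntegrable.ae_hasDerivAt_integral (locallyIntegrable_squareWave T)]
    with t ht
  exact (ht 0).sub_const _

lemma lipschitzWith_perfectSpline_one (T : ℝ) : LipschitzWith 1 (perfectSpline T 1) := by
  refine LipschitzWith.of_dist_le_mul fun u w => ?_
  have e : perfectSpline T 1 u - perfectSpline T 1 w = ∫ v in w..u, squareWave T v := by
    have h := intervalIntegral.integral_interval_sub_left
      (intervalIntegrable_perfectSpline T 0 0 u) (intervalIntegrable_perfectSpline T 0 0 w)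
    simp only [perfectSpline] at h ⊢
    rw [← h]
    ring
  rw [Real.dist_eq, Real.dist_eq, e, NNReal.coe_one, ← Real.norm_eq_abs]
  refine intervalIntegral.norm_integral_le_of_norm_le_const fun v _ => ?_
  rcases squareWave_eq T v with h | h <;> simp [h]

lemma absolutelyContinuousOnInterval_perfectSpline_one (T a b : ℝ) :
    AbsolutelyContinuousOnInterval (perfectSpline T 1) a b :=
  (lipschitzWith_perfectSpline_one T).lipschitzOnWith.absolutelyContinuousOnInterval

lemma perfectSpline_antiperiodic {T : ℝ} (hT : 0 < T) (n : ℕ) :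
    Function.Antiperiodic (perfectSpline T n) (T / 2) := by
  induction n with
  | zero => exact squareWave_antiperiodic hT
  | succ n ih =>
    intro t
    have h1 := intervalIntegral.integral_add_adjacent_intervals
      (intervalIntegrable_perfectSpline T n 0 (T / 2))
      (intervalIntegrable_perfectSpline T n (T / 2) (t + T / 2))
    have h2 := intervalIntegral.integral_comp_add_right (a := 0) (b := t)
      (perfectSpline T n) (T / 2)
    simp only [ih _, intervalIntegral.integral_neg, zero_add] at h2
    simp only [perfectSpline]
    rw [← h1, ← h2]
    ring

lemma Function.Antiperiodic.periodic_of_half {f : ℝ → ℝ} {T : ℝ}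
    (h : Function.Antiperiodic f (T / 2)) : Function.Periodic f T := by
  have h2 := h.periodic_two_mul
  rwa [mul_div_cancel₀ T two_ne_zero] at h2

/-- On the first half of the period the perfect spline is a rescaled Euler polynomial. -/
lemma perfectSpline_of_mem {T : ℝ} (hT : 0 < T) (n : ℕ) {t : ℝ} (ht : t ∈ Set.Ico 0 (T / 2)) :
    perfectSpline T n t = T ^ n * halfEuler n (t / T) := by
  induction n generalizing t with
  | zero => rw [perfectSpline, squareWave_of_mem hT ht, pow_zero, one_mul, halfEuler_zero]
  | succ n ih =>
    have hint : ∀ u ∈ Set.Icc 0 (T / 2), ∫ v in (0 : ℝ)..u, perfectSpline T n v =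
        T ^ (n + 1) * (halfEuler (n + 1) (u / T) - halfEuler (n + 1) 0) := by
      intro u hu
      have h1 : ∫ v in (0 : ℝ)..u, perfectSpline T n v =
          ∫ v in (0 : ℝ)..u, T ^ n * halfEuler n (v / T) := by
        refine intervalIntegral.integral_congr_uIoo fun v hv => ?_
        rw [Set.uIoo_of_le hu.1] at hv
        exact ih ⟨hv.1.le, hv.2.trans_le hu.2⟩
      have hc : Continuous (halfEuler n) := by
        unfold halfEuler
        exact continuous_const.mul (((continuous_normBernoulli _).comp (by fun_prop)).sub
          (continuous_normBernoulli _))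
      rw [h1, intervalIntegral.integral_const_mul, intervalIntegral.integral_comp_div _ hT.ne',
        intervalIntegral.integral_eq_sub_of_hasDerivAt (fun v _ => hasDerivAt_halfEuler n v)
          (hc.intervalIntegrable _ _), zero_div, smul_eq_mul]
      ring
    simp only [perfectSpline]
    rw [hint t ⟨ht.1, ht.2.le⟩, hint (T / 2) ⟨by positivity, le_rfl⟩,
      show T / 2 / T = 1 / 2 by field_simp, halfEuler_half]
    ring

lemma abs_perfectSpline_extremalPoint {T : ℝ} (hT : 0 < T) (n : ℕ) :
    |perfectSpline T n (T * extremalPoint n)| = (favardConst n : ℝ) * T ^ n := by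
  have hmem : T * extremalPoint n ∈ Set.Ico 0 (T / 2) := by
    unfold extremalPoint
    split_ifs <;> constructor <;> linarith
  rw [perfectSpline_of_mem hT n hmem, mul_div_cancel_left₀ _ hT.ne', abs_mul,
    abs_of_pos (pow_pos hT n), ← favardConst_eq_abs_halfEuler, mul_comm]

/-! ### Solutions from chains of primitives -/

lemma contDiff_of_chain {f : ℕ → ℝ → ℝ} (h1 : Continuous (f 1))
    (hf : ∀ n t, HasDerivAt (f (n + 2)) (f (n + 1) t) t) (n : ℕ) : ContDiff ℝ n (f (n + 1)) := by
  induction n with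
  | zero => exact contDiff_zero.2 h1
  | succ n ih =>
    rw [Nat.cast_succ, contDiff_succ_iff_deriv]
    refine ⟨fun t => (hf n t).differentiableAt, by simp, ?_⟩
    rwa [show deriv (f (n + 1 + 1)) = f (n + 1) from funext fun t => (hf n t).deriv]

lemma iteratedDeriv_of_chain {f : ℕ → ℝ → ℝ}
    (hf : ∀ n t, HasDerivAt (f (n + 2)) (f (n + 1) t) t) (n : ℕ) :
    iteratedDeriv n (f (n + 1)) = f 1 := by
  induction n with
  | zero => exact iteratedDeriv_zero
  | succ n ih =>
    rw [iteratedDeriv_succ', show deriv (f (n + 1 + 1)) = f (n + 1) from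
      funext fun t => (hf n t).deriv, ih]

/-- A chain of primitives solves the equation whose interval `[τ t, θ t]` is the single point `σ t`
as soon as its lowest member satisfies the corresponding first-order relation. -/
lemma isMaximaSolution_of_chain {f : ℕ → ℝ → ℝ} {q σ : ℝ → ℝ}
    (hf : ∀ n t, HasDerivAt (f (n + 2)) (f (n + 1) t) t)
    (hac : ∀ a b, AbsolutelyContinuousOnInterval (f 1) a b) (n : ℕ)
    (heq : ∀ᵐ t : ℝ, deriv (f 1) t = q t * f (n + 1) (σ t)) :
    IsMaximaSolution (n + 1) q σ σ (f (n + 1)) where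
  contDiff := by
    have h1 : Continuous (f 1) := continuous_iff_continuousAt.2 fun t =>
      (hac (t - 1) (t + 1)).continuousOn.continuousAt (by
        rw [Set.uIcc_of_le (by linarith)]
        exact Icc_mem_nhds (by linarith) (by linarith))
    exact_mod_cast contDiff_of_chain h1 hf n
  absolutelyContinuous := by
    rw [Nat.add_sub_cancel, iteratedDeriv_of_chain hf]
    exact hac
  equation := by
    rw [iteratedDeriv_succ, iteratedDeriv_of_chain hf]
    filter_upwards [heq] with t ht
    rw [ht, Set.Icc_self, Set.image_singleton, csSup_singleton]

lemma Function.Antiperiodic.not_const {f : ℝ → ℝ} {c t : ℝ} (h : Function.Antiperiodic f c)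
    (ht : f t ≠ 0) : ¬ ∃ a, ∀ s, f s = a := by
  rintro ⟨a, ha⟩
  have h1 := h t
  rw [ha, ha] at h1
  exact ht (by rw [ha]; linarith)

/-! ### Sharpness -/

theorem exists_solution_of_eq {n : ℕ} {T L : ℝ} (hn : 1 ≤ n) (hT : 0 < T)
    (hL : |L| * T ^ n = 1 / (favardConst n : ℝ)) :
    ∃ σ x : ℝ → ℝ, Measurable σ ∧
      IsNonconstantPeriodicMaximaSolution n T (fun _ => L) σ σ x := by
  obtain ⟨k, rfl⟩ : ∃ k, n = k + 1 := ⟨n - 1, by omega⟩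
  set φ := perfectSpline T (k + 1) with hφ
  set u := T * extremalPoint (k + 1) with hu
  have hanti : Function.Antiperiodic φ (T / 2) := perfectSpline_antiperiodic hT _
  have habs : |L * φ u| = 1 := by
    rw [abs_mul, hφ, hu, abs_perfectSpline_extremalPoint hT, mul_left_comm, hL,
      mul_one_div_cancel (favardConst_pos _ hn).ne']
  have hne : φ u ≠ 0 := fun h0 => by simp [h0] at habs
  let σ : ℝ → ℝ := fun t => if squareWave T t = L * φ u then u else u + T / 2
  have hσ : Measurable σ := Measurable.ite
    (measurable_squareWave T (measurableSet_singleton (L * φ u))) measurable_const measurable_const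
  have heq : ∀ t, squareWave T t = L * φ (σ t) := by
    intro t
    simp only [σ]
    split_ifs with h
    · exact h
    · rw [hanti u]
      rcases squareWave_eq T t with h1 | h1 <;>
        rcases eq_or_eq_neg_of_abs_eq habs with h2 | h2 <;> rw [h1, h2] at h <;>
        first | exact absurd rfl h | (rw [h1]; linarith)
  refine ⟨σ, φ, hσ, ?_, hanti.periodic_of_half, hanti.not_const hne⟩
  refine isMaximaSolution_of_chain (hasDerivAt_perfectSpline T)
    (absolutelyContinuousOnInterval_perfectSpline_one T) k ?_
  filter_upwards [ae_hasDerivAt_perfectSpline_one T] with t ht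
  rw [ht.deriv]
  exact heq t

lemma isPositivePeriodicCoeff_const {T c : ℝ} (hc : 0 < c) :
    IsPositivePeriodicCoeff T fun _ => c :=
  ⟨fun _ => hc, locallyIntegrable_const c, fun _ => rfl⟩

lemma favardConst_one : favardConst 1 = 1 / 4 := by
  norm_num [favardConst, bernoulli_eq_bernoulli'_of_ne_one (show (2 : ℕ) ≠ 1 by decide),
    Nat.factorial]

/-- The forward difference quotients of the perfect splines. Their `n`-th derivatives vanish except
near the jumps of the square wave, where they are large. -/
noncomputable def splineQuotient (T ε : ℝ) (n : ℕ) (t : ℝ) : ℝ :=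
  (perfectSpline T n (t + ε) - perfectSpline T n t) / ε

lemma hasDerivAt_splineQuotient (T ε : ℝ) (n : ℕ) (t : ℝ) :
    HasDerivAt (splineQuotient T ε (n + 2)) (splineQuotient T ε (n + 1) t) t :=
  (((hasDerivAt_perfectSpline T n (t + ε)).comp_add_const t ε).sub
    (hasDerivAt_perfectSpline T n t)).div_const ε

lemma ae_deriv_splineQuotient_one (T ε : ℝ) :
    ∀ᵐ t : ℝ, deriv (splineQuotient T ε 1) t = (squareWave T (t + ε) - squareWave T t) / ε := by
  have h := ae_hasDerivAt_perfectSpline_one T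
  filter_upwards [h, (measurePreserving_add_right volume ε).quasiMeasurePreserving.ae h]
    with t h1 h2
  exact (((h2.comp_add_const t ε).sub h1).div_const ε).deriv

lemma absolutelyContinuousOnInterval_splineQuotient_one (T ε a b : ℝ) :
    AbsolutelyContinuousOnInterval (splineQuotient T ε 1) a b := by
  have h : AbsolutelyContinuousOnInterval (fun t => perfectSpline T 1 (t + ε)) a b :=
    ((lipschitzWith_perfectSpline_one T).comp
      (LipschitzWith.id.add (LipschitzWith.const ε))).lipschitzOnWith.absolutelyContinuousOnInterval
  have h2 := (h.fun_sub (absolutelyContinuousOnInterval_perfectSpline_one T a b)).const_mul ε⁻¹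
  convert! h2 using 1
  funext t
  rw [splineQuotient, div_eq_inv_mul]

lemma splineQuotient_antiperiodic {T : ℝ} (hT : 0 < T) (ε : ℝ) (n : ℕ) :
    Function.Antiperiodic (splineQuotient T ε n) (T / 2) := by
  intro t
  have h := perfectSpline_antiperiodic hT n
  rw [splineQuotient, splineQuotient, add_right_comm, h, h]
  ring

open Classical in
/-- The coefficient equal to `p₁` where the shift by `ε` changes the square wave, and to `p₀`
elsewhere. -/
noncomputable def stepCoeff (T ε p₀ p₁ t : ℝ) : ℝ :=
  if squareWave T (t + ε) = squareWave T t then p₀ else p₁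

lemma measurableSet_squareWave_shift (T ε : ℝ) :
    MeasurableSet {t | squareWave T (t + ε) = squareWave T t} :=
  measurableSet_eq_fun ((measurable_squareWave T).comp (measurable_id.add_const ε))
    (measurable_squareWave T)

lemma stepCoeff_periodic_half {T : ℝ} (hT : 0 < T) (ε p₀ p₁ : ℝ) :
    Function.Periodic (stepCoeff T ε p₀ p₁) (T / 2) := by
  intro t
  have h := squareWave_antiperiodic hT
  unfold stepCoeff
  simp only [add_right_comm t (T / 2) ε, h _, neg_inj]

lemma isPositivePeriodicCoeff_stepCoeff {T ε p₀ p₁ : ℝ} (hT : 0 < T) (h₀ : 0 < p₀) (h₁ : 0 < p₁) :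
    IsPositivePeriodicCoeff T (stepCoeff T ε p₀ p₁) where
  pos t := by
    unfold stepCoeff
    split_ifs <;> assumption
  locallyIntegrable := by
    refine locallyIntegrable_of_bound (Measurable.ite (measurableSet_squareWave_shift T ε)
      measurable_const measurable_const) (C := p₀ + p₁) fun t => ?_
    unfold stepCoeff
    split_ifs
    · rw [abs_of_pos h₀]; linarith
    · rw [abs_of_pos h₁]; linarith
  periodic := by
    have h := (stepCoeff_periodic_half hT ε p₀ p₁).add_period (stepCoeff_periodic_half hT ε p₀ p₁)
    rwa [add_halves] at h

lemma integral_stepCoeff {T ε : ℝ} (hε : 0 < ε) (hεT : ε < T / 2) (p₀ p₁ : ℝ) :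
    ∫ t in (0 : ℝ)..T, stepCoeff T ε p₀ p₁ t = p₀ * (T - 2 * ε) + 2 * ε * p₁ := by
  have hT : 0 < T := by linarith
  have hper := stepCoeff_periodic_half hT ε p₀ p₁
  have e1 : Set.EqOn (stepCoeff T ε p₀ p₁) (fun _ => p₀) (Set.Ioo 0 (T / 2 - ε)) := by
    intro t ht
    rw [stepCoeff, if_pos]
    rw [squareWave_of_mem hT ⟨by linarith [ht.1], by linarith [ht.2]⟩,
      squareWave_of_mem hT ⟨ht.1.le, by linarith [ht.2]⟩]
  have e2 : Set.EqOn (stepCoeff T ε p₀ p₁) (fun _ => p₁) (Set.Ioo (T / 2 - ε) (T / 2)) := by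
    intro t ht
    have h1 := squareWave_antiperiodic hT (t + ε - T / 2)
    rw [sub_add_cancel, squareWave_of_mem (t := t + ε - T / 2) hT
      ⟨by linarith [ht.1], by linarith [ht.2]⟩] at h1
    rw [stepCoeff, if_neg]
    rw [h1, squareWave_of_mem hT ⟨by linarith [ht.1], ht.2⟩]
    norm_num
  have i1 : IntervalIntegrable (stepCoeff T ε p₀ p₁) volume 0 (T / 2 - ε) :=
    (intervalIntegrable_congr_uIoo (by rwa [Set.uIoo_of_le (by linarith)])).2
      intervalIntegrable_const
  have i2 : IntervalIntegrable (stepCoeff T ε p₀ p₁) volume (T / 2 - ε) (T / 2) :=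
    (intervalIntegrable_congr_uIoo (by rwa [Set.uIoo_of_le (by linarith)])).2
      intervalIntegrable_const
  have hhalf : ∫ t in (0 : ℝ)..(T / 2), stepCoeff T ε p₀ p₁ t = p₀ * (T / 2 - ε) + ε * p₁ := by
    rw [← intervalIntegral.integral_add_adjacent_intervals i1 i2,
      intervalIntegral.integral_congr_Ioo_of_le (by linarith) e1,
      intervalIntegral.integral_congr_Ioo_of_le (by linarith) e2,
      intervalIntegral.integral_const, intervalIntegral.integral_const, smul_eq_mul, smul_eq_mul]
    ring
  have hsnd := hper.intervalIntegral_add_eq (T / 2) 0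
  rw [zero_add, add_halves] at hsnd
  have i3 : IntervalIntegrable (stepCoeff T ε p₀ p₁) volume (T / 2) T := by
    have h := (i1.trans i2).comp_sub_right (T / 2)
    rw [zero_add, add_halves] at h
    exact h.congr_ae (Filter.Eventually.of_forall fun t => hper.sub_eq t)
  rw [← intervalIntegral.integral_add_adjacent_intervals (i1.trans i2) i3, hsnd, hhalf]
  ring

theorem exists_solution_of_lt {n : ℕ} {T P : ℝ} (hn : 2 ≤ n) (hT : 0 < T)
    (hP : 4 / (favardConst (n - 1) : ℝ) < P * T ^ (n - 1)) :
    ∃ p σ x : ℝ → ℝ, Measurable σ ∧ IsPositivePeriodicCoeff T p ∧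
      (∫ t in (0 : ℝ)..T, p t) = P ∧ IsNonconstantPeriodicMaximaSolution n T p σ σ x := by
  obtain ⟨k, rfl⟩ : ∃ k, n = k + 2 := ⟨n - 2, by omega⟩
  rw [show k + 2 - 1 = k + 1 by omega] at hP
  have hK := favardConst_pos (k + 1) (by omega)
  have hTk := pow_pos hT (k + 1)
  have hPpos : 0 < P := pos_of_mul_pos_left ((by positivity : (0 : ℝ) < 4 / _).trans hP) hTk.le
  set u := T * extremalPoint (k + 1) with hu
  -- As `ε → 0` the difference quotient at `u` tends to the value of the spline of lower degree.
  have hlim : Filter.Tendsto (fun ε => |splineQuotient T ε (k + 2) u|) (nhdsWithin 0 (Set.Ioi 0))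
      (nhds ((favardConst (k + 1) : ℝ) * T ^ (k + 1))) := by
    rw [← abs_perfectSpline_extremalPoint hT (k + 1)]
    refine ((hasDerivAt_perfectSpline T k u).tendsto_slope_zero_right.congr fun ε => ?_).abs
    rw [smul_eq_mul, splineQuotient, div_eq_inv_mul]
  have hlt : 4 / P < (favardConst (k + 1) : ℝ) * T ^ (k + 1) := by
    rw [div_lt_iff₀ hK] at hP
    rw [div_lt_iff₀ hPpos]
    linarith
  obtain ⟨ε, hεv, hε0, hεT⟩ := ((hlim.eventually_const_lt hlt).and
    (Ioo_mem_nhdsGT (show (0 : ℝ) < T / 2 by positivity))).exists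
  set x := splineQuotient T ε (k + 2) with hx
  set v := |x u| with hv
  have hvpos : 0 < v := (by positivity : (0 : ℝ) < 4 / P).trans hεv
  have hanti : Function.Antiperiodic x (T / 2) := splineQuotient_antiperiodic hT ε _
  have hcont : Continuous x :=
    continuous_iff_continuousAt.2 fun t => (hasDerivAt_splineQuotient T ε k t).continuousAt
  obtain ⟨w, hw⟩ : ∃ w, x w = 0 := by
    rcases le_total (x u) 0 with h | h
    · exact mem_range_of_exists_le_of_exists_ge hcont ⟨u, h⟩
        ⟨u + T / 2, by rw [hanti u]; linarith⟩
    · exact mem_range_of_exists_le_of_exists_ge hcont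
        ⟨u + T / 2, by rw [hanti u]; linarith⟩ ⟨u, h⟩
  have hden : 0 < T - 2 * ε := by linarith
  have hp₀ : 0 < (P - 4 / v) / (T - 2 * ε) := by
    refine div_pos (sub_pos.2 ?_) hden
    rw [div_lt_iff₀ hvpos]
    rwa [div_lt_iff₀ hPpos, mul_comm] at hεv
  have hp₁ : 0 < 2 / (ε * v) := by positivity
  classical
  let σ : ℝ → ℝ := fun t => if squareWave T (t + ε) = squareWave T t then w
    else if squareWave T t * x u < 0 then u else u + T / 2
  have hσ : Measurable σ := Measurable.ite (measurableSet_squareWave_shift T ε) measurable_const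
    (Measurable.ite (measurableSet_lt ((measurable_squareWave T).mul_const _) measurable_const)
      measurable_const measurable_const)
  have heq : ∀ t, (squareWave T (t + ε) - squareWave T t) / ε =
      stepCoeff T ε ((P - 4 / v) / (T - 2 * ε)) (2 / (ε * v)) t * x (σ t) := by
    intro t
    simp only [σ, stepCoeff]
    by_cases h : squareWave T (t + ε) = squareWave T t
    · simp [h, hw]
    · rw [if_neg h, if_neg h]
      have hopp : squareWave T (t + ε) = -squareWave T t := by
        rcases squareWave_eq T t with h1 | h1 <;> rcases squareWave_eq T (t + ε) with h2 | h2 <;>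
          rw [h1, h2] at h ⊢ <;> first | exact absurd rfl h | norm_num
      have hval : x (if squareWave T t * x u < 0 then u else u + T / 2) = -squareWave T t * v := by
        split_ifs with hs
        · rw [hv]
          rcases squareWave_eq T t with h1 | h1 <;> rw [h1] at hs ⊢
          · rw [abs_of_neg (by linarith)]; ring
          · rw [abs_of_pos (by linarith)]; ring
        · rw [hanti u, hv]
          rcases squareWave_eq T t with h1 | h1 <;> rw [h1] at hs ⊢
          · rw [abs_of_nonneg (by linarith)]; ring
          · rw [abs_of_nonpos (by linarith)]; ring
      rw [hval, hopp]
      field_simp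
      ring
  refine ⟨_, σ, x, hσ, isPositivePeriodicCoeff_stepCoeff (ε := ε) hT hp₀ hp₁, ?_,
    ?_, hanti.periodic_of_half, hanti.not_const (abs_pos.1 hvpos)⟩
  · rw [integral_stepCoeff hε0 hεT]
    field_simp
    ring
  · refine isMaximaSolution_of_chain (hasDerivAt_splineQuotient T ε)
      (absolutelyContinuousOnInterval_splineQuotient_one T ε) (k + 1) ?_
    filter_upwards [ae_deriv_splineQuotient_one T ε] with t ht
    rw [ht]
    exact heq t

theorem mainTheorem4 :
    -- constant coefficient: the necessary condition
    (∀ (n : ℕ) (T L : ℝ) (τ θ x : ℝ → ℝ), 1 ≤ n → 0 < T →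
      AEMeasurable τ volume → AEMeasurable θ volume → (∀ t : ℝ, τ t ≤ θ t) →
      IsNonconstantPeriodicMaximaSolution n T (fun _ => L) τ θ x →
        1 / (favardConst n : ℝ) ≤ |L| * T ^ n) ∧
    -- constant coefficient: equality is attained, for every order, every period and both signs
    (∀ (n : ℕ) (T L : ℝ), 1 ≤ n → 0 < T → |L| * T ^ n = 1 / (favardConst n : ℝ) →
      ∃ τ θ x : ℝ → ℝ, Measurable τ ∧ Measurable θ ∧ (∀ t : ℝ, τ t ≤ θ t) ∧
        IsNonconstantPeriodicMaximaSolution n T (fun _ => L) τ θ x) ∧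
    -- periodic coefficient: the necessary conditions
    (∀ (n : ℕ) (T : ℝ) (p τ θ x : ℝ → ℝ), 1 ≤ n → 0 < T →
      AEMeasurable τ volume → AEMeasurable θ volume → (∀ t : ℝ, τ t ≤ θ t) →
      IsPositivePeriodicCoeff T p →
      IsNonconstantPeriodicMaximaSolution n T p τ θ x →
        (n = 1 → 4 ≤ ∫ t in (0 : ℝ)..T, p t) ∧
        (2 ≤ n → 4 / (favardConst (n - 1) : ℝ) < (∫ t in (0 : ℝ)..T, p t) * T ^ (n - 1))) ∧
    -- periodic coefficient, order one: equality is attained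
    (∀ T : ℝ, 0 < T →
      ∃ p τ θ x : ℝ → ℝ, Measurable τ ∧ Measurable θ ∧ (∀ t : ℝ, τ t ≤ θ t) ∧
        IsPositivePeriodicCoeff T p ∧ (∫ t in (0 : ℝ)..T, p t) = 4 ∧
        IsNonconstantPeriodicMaximaSolution 1 T p τ θ x) ∧
    -- periodic coefficient, higher order: every value above the bound is attained
    (∀ (n : ℕ) (T P : ℝ), 2 ≤ n → 0 < T → 4 / (favardConst (n - 1) : ℝ) < P * T ^ (n - 1) →
      ∃ p τ θ x : ℝ → ℝ, Measurable τ ∧ Measurable θ ∧ (∀ t : ℝ, τ t ≤ θ t) ∧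
        IsPositivePeriodicCoeff T p ∧ (∫ t in (0 : ℝ)..T, p t) = P ∧
        IsNonconstantPeriodicMaximaSolution n T p τ θ x) := by
  refine ⟨fun n T L τ θ x hn hT _ _ hle h => one_div_favardConst_le hn hT hle h, ?_,
    fun n T p τ θ x hn hT _ _ hle hp h => ⟨?_, fun h2 => four_div_favardConst_lt h2 hT hle hp h⟩,
    ?_, ?_⟩
  · intro n T L hn hT hL
    obtain ⟨σ, x, hσ, hx⟩ := exists_solution_of_eq hn hT hL
    exact ⟨σ, σ, x, hσ, hσ, fun _ => le_rfl, hx⟩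
  · rintro rfl
    exact four_le_integral hT hle hp h
  · intro T hT
    have hpos : 0 < 4 / T := by positivity
    obtain ⟨σ, x, hσ, hx⟩ := exists_solution_of_eq (n := 1) (L := 4 / T) le_rfl hT (by
      rw [abs_of_pos hpos, favardConst_one]
      field_simp
      norm_num)
    refine ⟨fun _ => 4 / T, σ, σ, x, hσ, hσ, fun _ => le_rfl, isPositivePeriodicCoeff_const hpos,
      ?_, hx⟩
    rw [intervalIntegral.integral_const, smul_eq_mul, sub_zero, mul_div_cancel₀ _ hT.ne']
  · intro n T P hn hT hP
    obtain ⟨p, σ, x, hσ, hp, hint, hx⟩ := exists_solution_of_lt hn hT hP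
    exact ⟨p, σ, σ, x, hσ, hσ, fun _ => le_rfl, hp, hint, hx⟩
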